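/- Let $\overline M$ be a compact smooth manifold with boundary $\partial M$ (Hausdorff, of dimension $n\ge 1$), for instance a scattering manifold, and let $M$ be its interior. Let $H^1(\overline M,\partial M)$ be the first cohomology of the complex $\Omega^k(\overline M)\oplus\Omega^{k-1}(\partial M)$ with differential $d(\alpha,\theta)=(d\alpha,\,i^*\alpha-d\theta)$, where $i:\partial M\to\overline M$ is the inclusion, and let $H^1_{\partial M}(M)$ be the image of the natural map $H^1(\overline M,\partial M)\to H^1(\overline M)$, regarded as a subspace of the de Rham space $H^1(M)$ by restriction to $M$. A real smooth closed 1-form $\omega$ on $M$ is called *integral* if $\int_\sigma\omega\in 2\pi\mathbb Z$ for every smooth 1-cycle $\sigma$ in $M$; *rational* if $q\omega$ is integral for some integer $q\neq 0$; and *Liouville* if it is not rational and there are closed integral 1-forms $\theta_j$ on $M$ and integers $q_j\ge 2$ with $q_j\to\infty$ such that the sequence $q_j^{\,j}\,(\omega-\theta_j/q_j)$, $j\in\mathbb N$, is bounded in the standard Fréchet topology of smooth 1-forms on $M$. Let $\omega_1,\dots,\omega_{d'}$ be smooth closed 1-forms on $M$ whose classes form a basis of $H^1(M)$ and such that $[\omega_1],\dots,[\omega_d]$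 form a basis of $H^1_{\partial M}(M)$, and let $\sigma_1,\dots,\sigma_{d'}$ be smooth 1-cycles in $M$ whose classes form a $\mathbb Z$-basis of the free part $H_1(M;\mathbb Z)/\mathrm{torsion}$, dual to the forms in the sense that $\frac1{2\pi}\int_{\sigma_\ell}\omega_k=\delta_{k\ell}$. For a closed 1-form $\omega$ on $M$ with $[\omega]\in H^1_{\partial M}(M)$ put $$I([\omega])=\frac1{2\pi}\Big(\int_{\sigma_1}\omega,\dots,\int_{\sigma_d}\omega\Big)\in\mathbb R^d .$$ **Theorem.** Let $\omega$ be a real smooth closed 1-form on $M$ with $[\omega]\in H^1_{\partial M}(M)$. Then: 1. $\omega$ is integral if and only if $I([\omega])\in\mathbb Z^d$; 2. $\omega$ is rational if and only if $I([\omega])\in\mathbb Q^d$; 3. $\omega$ is Liouville if and only if $I([\omega])\notin\mathbb Q^d$ and there are sequences $p_j\in\mathbb Z^d$ and $q_j\in\mathbb N$ with $q_j\ge 2$ and $q_j\to\infty$, and a constant $C>0$, such that $\left|I([\omega])-\dfrac{p_j}{q_j}\right|\le \dfrac{C}{q_j^{\,j}}$ for all $j\in\mathbb N$, where $|\cdot|$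 is the $1$-norm on $\mathbb R^d$. -/

import Mathlib

open Set Filter Topology
open scoped Manifold ContDiff

noncomputable section

namespace ScatteringForms

theorem mvfderiv_const_mul {E : Type*} [NormedAddCommGroup E] [NormedSpace ℝ E]
    {H : Type*} [TopologicalSpace H] {I : ModelWithCorners ℝ E H}
    {M : Type*} [TopologicalSpace M] [ChartedSpace H M] (c : ℝ) {f : M → ℝ} {x : M} (hf : MDifferentiableAt I 𝓘(ℝ, ℝ) f x) :
    mvfderiv I (fun x => c * f x) x = c • mvfderiv I f x := by
  have h := mvfderiv_smul (I := I) (a := fun _ : M => c) mdifferentiableAt_const hf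
  have h' : (fun x => c * f x) = (fun _ : M => c) • f := rfl
  rw [h', h, mvfderiv_const]
  ext v
  simp

section General

variable {E : Type*} [NormedAddCommGroup E] [NormedSpace ℝ E]
  {H : Type*} [TopologicalSpace H] (I : ModelWithCorners ℝ E H)
  (M : Type*) [TopologicalSpace M] [ChartedSpace H M] [IsManifold I ∞ M]

/-- Real smooth 1-forms on `M` (smooth up to the boundary if `M` has one): smooth sections of the
cotangent bundle. -/
abbrev OneForm : Type _ :=
  ContMDiffSection I (E →L[ℝ] ℝ) ∞ (fun x : M => TangentSpace I x →L[ℝ] Bundle.Trivial M ℝ x)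

variable {I M}

/-- The coefficients of `α` in the chart at `x₀`: the pullback of `α` by the inverse chart, a
1-form on the chart's target in `E`. -/
def inChart (α : OneForm I M) (x₀ : M) (y : E) : E →L[ℝ] ℝ :=
  (show TangentSpace I ((extChartAt I x₀).symm y) →L[ℝ] ℝ from α ((extChartAt I x₀).symm y)).comp
    (mfderivWithin 𝓘(ℝ, E) I (extChartAt I x₀).symm (range I) y)

/-- `dα = 0`, expressed in the charts. -/
def IsClosedForm (α : OneForm I M) : Prop :=
  ∀ x₀ : M, ∀ y ∈ (extChartAt I x₀).target, ∀ v w : E,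
    fderivWithin ℝ (inChart α x₀) (range I) y v w = fderivWithin ℝ (inChart α x₀) (range I) y w v

/-- `α = df` on all of `M`. -/
def IsDifferentialOf (α : OneForm I M) (f : M → ℝ) : Prop :=
  ∀ (x : M) (v : TangentSpace I x), α x v = mvfderiv I f x v

/-- Boundedness of a sequence of 1-forms for the standard Fréchet topology: every derivative of the
coefficients is bounded on every compact subset of every chart, uniformly along the sequence. -/
def IsFrechetBounded (α : ℕ → OneForm I M) : Prop :=
  ∀ (x₀ : M) (K : Set E), IsCompact K → K ⊆ (extChartAt I x₀).target → ∀ k : ℕ,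
    ∃ C : ℝ, ∀ j : ℕ, ∀ y ∈ K, ‖iteratedFDerivWithin ℝ k (inChart (α j) x₀) (range I) y‖ ≤ C

theorem inChart_add (α β : OneForm I M) (x₀ : M) :
    inChart (α + β) x₀ = inChart α x₀ + inChart β x₀ := by
  ext y v
  rfl

theorem inChart_smul (c : ℝ) (α : OneForm I M) (x₀ : M) :
    inChart (c • α) x₀ = c • inChart α x₀ := by
  ext y v
  rfl

theorem inChart_zero (x₀ : M) : inChart (0 : OneForm I M) x₀ = 0 := by
  ext y v
  rfl

theorem contDiffOn_inChart [FiniteDimensional ℝ E] (α : OneForm I M) (x₀ : M) :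
    ContDiffOn ℝ ∞ (inChart α x₀) (extChartAt I x₀).target := by
  rw [contDiffOn_clm_apply]
  intro v
  have h1 : ContMDiffOn I (I.prod 𝓘(ℝ, E)) ∞
      (fun m : M => (⟨m, (trivializationAt E (TangentSpace I) x₀).symmL ℝ m v⟩ :
        TangentBundle I M)) (chartAt H x₀).source := by
    let e := trivializationAt E (TangentSpace I : M → Type _) x₀
    have h := (Bundle.Trivialization.contMDiffOn_symm (n := ∞) (IB := I) e).comp
      (t := e.target) (s := e.baseSet) (f := fun m : M => (m, v)) (I := I)
      (contMDiffOn_id.prodMk contMDiffOn_const) (fun m hm => by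
        simpa [e.mem_target] using hm)
    refine (h.congr fun m hm => ?_).mono (by simp [e])
    simp only [Function.comp]
    rw [← e.mk_symm hm, e.symmL_apply hm]
  have h2 : ContMDiffOn I 𝓘(ℝ, ℝ) ∞
      (fun m : M => α m ((trivializationAt E (TangentSpace I) x₀).symmL ℝ m v))
      (chartAt H x₀).source := by
    have h := (ContMDiff.contMDiffOn (s := (chartAt H x₀).source)
      α.contMDiff_toFun).clm_bundle_apply h1
    intro x hx
    exact ((Bundle.contMDiffWithinAt_section).1 (h x hx))
  have h3 := h2.comp (contMDiffOn_extChartAt_symm x₀) (fun y hy => by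
    simpa using (extChartAt I x₀).map_target hy)
  rw [← contMDiffOn_iff_contDiffOn]
  refine h3.congr fun y hy => ?_
  have hs : (extChartAt I x₀).symm y ∈ (chartAt H x₀).source := by
    simpa using (extChartAt I x₀).map_target hy
  simp only [inChart, Function.comp]
  rw [TangentBundle.symmL_trivializationAt hs, (extChartAt I x₀).right_inv hy]
  rfl

theorem differentiableWithinAt_inChart [FiniteDimensional ℝ E] (α : OneForm I M) (x₀ : M) {y : E}
    (hy : y ∈ (extChartAt I x₀).target) :
    DifferentiableWithinAt ℝ (inChart α x₀) (range I) y :=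
  (((contDiffOn_inChart α x₀) y hy).differentiableWithinAt (by simp)).mono_of_mem_nhdsWithin
    (extChartAt_target_mem_nhdsWithin_of_mem hy)

variable (I M) in
/-- The space of smooth closed 1-forms. -/
def closedForms [FiniteDimensional ℝ E] : Submodule ℝ (OneForm I M) where
  carrier := {α | IsClosedForm α}
  zero_mem' := by
    intro x₀ y _ v w
    simp [inChart_zero]
  add_mem' := by
    intro α β hα hβ x₀ y hy v w
    have hu : UniqueDiffWithinAt ℝ (range I) y :=
      I.uniqueDiffOn y (extChartAt_target_subset_range x₀ hy)
    rw [inChart_add, fderivWithin_add hu (differentiableWithinAt_inChart α x₀ hy)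
      (differentiableWithinAt_inChart β x₀ hy)]
    simp [hα x₀ y hy v w, hβ x₀ y hy v w]
  smul_mem' := by
    intro c α hα x₀ y hy v w
    have hu : UniqueDiffWithinAt ℝ (range I) y :=
      I.uniqueDiffOn y (extChartAt_target_subset_range x₀ hy)
    rw [inChart_smul, fderivWithin_const_smul hu (differentiableWithinAt_inChart α x₀ hy)]
    simp [hα x₀ y hy v w]

variable (I M) in
/-- The exact forms, as a subspace of the closed ones. -/
def exactForms [FiniteDimensional ℝ E] : Submodule ℝ (closedForms I M) where
  carrier := {α | ∃ f : M → ℝ, ContMDiff I 𝓘(ℝ, ℝ) ∞ f ∧ IsDifferentialOf (α : OneForm I M) f}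
  zero_mem' := ⟨fun _ => 0, contMDiff_const, fun x v => by simp [mvfderiv_const]⟩
  add_mem' := by
    rintro α β ⟨f, hf, hαf⟩ ⟨g, hg, hβg⟩
    refine ⟨f + g, hf.add hg, fun x v => ?_⟩
    rw [mvfderiv_add (hf.mdifferentiable (by simp) x) (hg.mdifferentiable (by simp) x)]
    simp [← hαf x v, ← hβg x v]
  smul_mem' := by
    rintro c α ⟨f, hf, hαf⟩
    refine ⟨fun x => c * f x, contMDiff_const.mul hf, fun x v => ?_⟩
    rw [mvfderiv_const_mul c (hf.mdifferentiable (by simp) x)]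
    simp [← hαf x v]

variable (I M) in
/-- The first de Rham cohomology space `H¹(M)`. -/
abbrev DeRhamH1 [FiniteDimensional ℝ E] : Type _ := closedForms I M ⧸ exactForms I M

/-! ### Smooth singular 1-cycles and first integral homology -/

variable (I M) in
/-- Smooth singular 1-simplices of `M`. -/
structure SmoothPath where
  /-- the underlying map -/
  toFun : unitInterval → M
  smooth : ContMDiffOn 𝓘(ℝ, ℝ) I ∞ (IccExtend zero_le_one toFun) (Icc 0 1)

/-- A smooth path as a map on `ℝ`, constant on both sides of `[0, 1]`. -/
def SmoothPath.extend (γ : SmoothPath I M) : ℝ → M := IccExtend zero_le_one γ.toFun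

/-- The standard triangle, with vertices `(0, 0)`, `(1, 0)`, `(0, 1)`. -/
def triangle : Set (ℝ × ℝ) := {p | 0 ≤ p.1 ∧ 0 ≤ p.2 ∧ p.1 + p.2 ≤ 1}

variable (I M) in
/-- Smooth singular 2-simplices of `M`; the values of `toFun` off the triangle play no role. -/
structure SmoothTriangle where
  /-- the underlying map -/
  toFun : ℝ × ℝ → M
  smooth : ContMDiffOn 𝓘(ℝ, ℝ × ℝ) I ∞ toFun triangle

/-- The restriction of a smooth 2-simplex to a smooth curve in the triangle. -/
def SmoothTriangle.face (τ : SmoothTriangle I M) (a : ℝ → ℝ × ℝ) (ha : ContDiff ℝ ∞ a)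
    (hm : MapsTo a (Icc 0 1) triangle) : SmoothPath I M where
  toFun t := τ.toFun (a t)
  smooth := by
    refine (τ.smooth.comp (ha.contMDiff.contMDiffOn (s := Icc 0 1)) hm).congr fun t ht => ?_
    rw [IccExtend_of_mem _ _ ht]
    rfl

variable (I M) in
/-- Smooth singular 1-chains with integer coefficients. -/
abbrev OneChain : Type _ := SmoothPath I M →₀ ℤ

/-- The boundary of a smooth 2-simplex: `[v₁, v₂] - [v₀, v₂] + [v₀, v₁]`. -/
def SmoothTriangle.boundary (τ : SmoothTriangle I M) : OneChain I M :=
  Finsupp.single (τ.face (fun t => (1 - t, t)) (by fun_prop)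
      (fun t ht => ⟨by linarith [ht.2], ht.1, by simp⟩)) 1
    - Finsupp.single (τ.face (fun t => (0, t)) (by fun_prop)
      (fun t ht => ⟨le_rfl, ht.1, by simpa using ht.2⟩)) 1
    + Finsupp.single (τ.face (fun t => (t, 0)) (by fun_prop)
      (fun t ht => ⟨ht.1, le_rfl, by simpa using ht.2⟩)) 1

variable (I M) in
/-- The boundary operator from 1-chains to 0-chains. -/
def boundaryMap : OneChain I M →ₗ[ℤ] (M →₀ ℤ) :=
  Finsupp.linearCombination ℤ
    (fun γ : SmoothPath I M => Finsupp.single (γ.toFun 1) 1 - Finsupp.single (γ.toFun 0) 1)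

variable (I M) in
/-- Smooth 1-cycles. -/
def cycles : Submodule ℤ (OneChain I M) := LinearMap.ker (boundaryMap I M)

variable (I M) in
/-- Smooth 1-boundaries. -/
def boundaries : Submodule ℤ (OneChain I M) :=
  Submodule.span ℤ (range (SmoothTriangle.boundary : SmoothTriangle I M → OneChain I M))

variable (I M) in
/-- `H₁(M; ℤ)`. -/
abbrev IntegralH1 : Type _ := cycles I M ⧸ (boundaries I M).submoduleOf (cycles I M)

variable (I M) in
/-- The free part of `H₁(M; ℤ)`: its quotient by the torsion subgroup. -/
abbrev FreeH1 : Type _ := IntegralH1 I M ⧸ Submodule.torsion ℤ (IntegralH1 I M)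

/-- The class of a smooth 1-cycle in the free part of `H₁(M; ℤ)`. -/
def freeClass (σ : cycles I M) : FreeH1 I M := Submodule.Quotient.mk (Submodule.Quotient.mk σ)

/-- `∫_γ α` along a smooth path. -/
def pathIntegral (α : OneForm I M) (γ : SmoothPath I M) : ℝ :=
  ∫ t in (0 : ℝ)..1,
    (α (γ.extend t) (mfderivWithin 𝓘(ℝ, ℝ) I γ.extend (Icc 0 1) t (1 : ℝ)) : ℝ)

/-- `∫_c α` over a smooth 1-chain. -/
def chainIntegral (α : OneForm I M) (c : OneChain I M) : ℝ :=
  c.sum fun γ m => (m : ℝ) * pathIntegral α γ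

/-! ### Arithmetic properties of closed 1-forms -/

/-- All periods are in `2πℤ`. -/
def IsIntegralForm (α : OneForm I M) : Prop :=
  ∀ σ ∈ cycles I M, ∃ m : ℤ, chainIntegral α σ = 2 * Real.pi * m

/-- Some nonzero integer multiple is integral. -/
def IsRationalForm (α : OneForm I M) : Prop :=
  ∃ q : ℤ, q ≠ 0 ∧ IsIntegralForm ((q : ℝ) • α)

/-- `α` is not rational, and is approximated by rational forms `θ j / q j` at the rate
`(q j) ^ (-j)` in the Fréchet topology. -/
def IsLiouvilleForm (α : OneForm I M) : Prop :=
  ¬ IsRationalForm α ∧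
    ∃ (θ : ℕ → OneForm I M) (q : ℕ → ℤ),
      (∀ j, IsClosedForm (θ j) ∧ IsIntegralForm (θ j)) ∧ (∀ j, 2 ≤ q j) ∧ Tendsto q atTop atTop ∧
      IsFrechetBounded fun j => ((q j : ℝ) ^ j) • (α - (q j : ℝ)⁻¹ • θ j)

/-- The vector `(1/2π) (∫_{σ₁} α, …, ∫_{σ_d} α)`. -/
def periodVector {d : ℕ} (σ : Fin d → cycles I M) (α : OneForm I M) (l : Fin d) : ℝ :=
  1 / (2 * Real.pi) * chainIntegral α (σ l : OneChain I M)

end General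

section Boundary

variable (n : ℕ) [NeZero n] (Mbar : Type*) [TopologicalSpace Mbar]
  [ChartedSpace (EuclideanHalfSpace n) Mbar] [IsManifold (𝓡∂ n) ∞ Mbar]

/-- The interior `M` of a smooth manifold with boundary, as an open submanifold. -/
def interiorOpens : TopologicalSpace.Opens Mbar :=
  ⟨(𝓡∂ n).interior Mbar, ModelWithCorners.isOpen_interior (n := ∞) (by simp)⟩

/-- The manifold `M`, the interior of `Mbar`. -/
abbrev Interior : Type _ := ↥(interiorOpens n Mbar)

variable {n Mbar}

/-- A tangent vector of `Mbar` at a boundary point `p` is tangent to `∂M` iff its component along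
the first coordinate of a boundary chart, which defines `∂M`, vanishes. -/
def IsTangentToBoundary (p : Mbar) (v : TangentSpace (𝓡∂ n) p) : Prop :=
  (show EuclideanSpace ℝ (Fin n) from mvfderiv (𝓡∂ n) (extChartAt (𝓡∂ n) p) p v) 0 = 0

/-- `(α, θ|_{∂M})` is a 1-cocycle of the relative de Rham complex
`Ω¹(Mbar) ⊕ C^∞(∂M)`, `d(α, θ) = (dα, i^*α - dθ)`, where `i : ∂M → Mbar` is the inclusion.
Since `∂M` is a closed submanifold, each smooth function on it is the restriction of
some smooth `θ : Mbar → ℝ`. -/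
def IsRelativeCocycle (α : OneForm (𝓡∂ n) Mbar) (θ : Mbar → ℝ) : Prop :=
  IsClosedForm α ∧ ContMDiff (𝓡∂ n) 𝓘(ℝ, ℝ) ∞ θ ∧
    ∀ p ∈ (𝓡∂ n).boundary Mbar, ∀ v : TangentSpace (𝓡∂ n) p, IsTangentToBoundary p v →
      α p v = mvfderiv (𝓡∂ n) θ p v

/-- `β` is the restriction to `M` of the form `α` on `Mbar`, i.e. its pullback by the inclusion. -/
def IsRestriction (β : OneForm (𝓡∂ n) (Interior n Mbar)) (α : OneForm (𝓡∂ n) Mbar) : Prop :=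
  ∀ (x : Interior n Mbar) (v : TangentSpace (𝓡∂ n) x),
    β x v = α x.1 (mfderiv (𝓡∂ n) (𝓡∂ n) (Subtype.val : Interior n Mbar → Mbar) x v)

variable (n Mbar)

/-- `H¹_{∂M}(M)`: the image of `H¹(Mbar, ∂M) → H¹(Mbar)`, regarded as a subspace of `H¹(M)` by
restriction to the interior. -/
def relativeImage : Submodule ℝ (DeRhamH1 (𝓡∂ n) (Interior n Mbar)) where
  carrier := {c | ∃ (β : closedForms (𝓡∂ n) (Interior n Mbar)) (α : OneForm (𝓡∂ n) Mbar)
    (θ : Mbar → ℝ), IsRelativeCocycle α θ ∧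
      IsRestriction (β : OneForm (𝓡∂ n) (Interior n Mbar)) α ∧ Submodule.Quotient.mk β = c}
  zero_mem' := by
    refine ⟨0, 0, fun _ => 0, ⟨(closedForms (𝓡∂ n) Mbar).zero_mem, contMDiff_const, ?_⟩, ?_, rfl⟩
    · intro p _ v _
      simp [mvfderiv_const]
    · intro x v
      simp
  add_mem' := by
    rintro _ _ ⟨β, α, θ, ⟨h1, h2, h3⟩, h4, rfl⟩ ⟨β', α', θ', ⟨h1', h2', h3'⟩, h4', rfl⟩
    refine ⟨β + β', α + α', θ + θ', ⟨(closedForms (𝓡∂ n) Mbar).add_mem h1 h1', h2.add h2', ?_⟩,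
      ?_, rfl⟩
    · intro p hp v hv
      rw [mvfderiv_add (h2.mdifferentiable (by simp) p) (h2'.mdifferentiable (by simp) p)]
      simp [← h3 p hp v hv, ← h3' p hp v hv]
    · intro x v
      simp [h4 x v, h4' x v]
  smul_mem' := by
    rintro c _ ⟨β, α, θ, ⟨h1, h2, h3⟩, h4, rfl⟩
    refine ⟨c • β, c • α, fun p => c * θ p, ⟨(closedForms (𝓡∂ n) Mbar).smul_mem c h1,
      contMDiff_const.mul h2, ?_⟩, ?_, rfl⟩
    · intro p hp v hv
      rw [mvfderiv_const_mul c (h2.mdifferentiable (by simp) p)]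
      simp [← h3 p hp v hv]
    · intro x v
      simp [h4 x v]

variable {n Mbar}

/-- `β` lists closed 1-forms on `M` whose classes form a basis of `H¹(M)`, the first `d` of them a
basis of `H¹_{∂M}(M)`; `σ` lists smooth 1-cycles in `M` whose classes form a `ℤ`-basis of the free
part of `H₁(M; ℤ)`; and the two bases are dual for the pairing `(1/2π) ∫_σ β`. -/
structure IsDualSystem {d d' : ℕ} (hd : d ≤ d')
    (β : Fin d' → closedForms (𝓡∂ n) (Interior n Mbar))
    (σ : Fin d' → cycles (𝓡∂ n) (Interior n Mbar)) : Prop where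
  forms_linearIndependent : LinearIndependent ℝ
    fun k => (Submodule.Quotient.mk (β k) : DeRhamH1 (𝓡∂ n) (Interior n Mbar))
  forms_span : Submodule.span ℝ (range
    fun k => (Submodule.Quotient.mk (β k) : DeRhamH1 (𝓡∂ n) (Interior n Mbar))) = ⊤
  relative_span : Submodule.span ℝ (range fun k : Fin d =>
    (Submodule.Quotient.mk (β (Fin.castLE hd k)) : DeRhamH1 (𝓡∂ n) (Interior n Mbar)))
      = relativeImage n Mbar
  cycles_linearIndependent : LinearIndependent ℤ fun l => freeClass (σ l)
  cycles_span : Submodule.span ℤ (range fun l => freeClass (σ l)) = ⊤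
  dual : ∀ k l, periodVector σ (β k : OneForm (𝓡∂ n) (Interior n Mbar)) l = if k = l then 1 else 0

end Boundary

end ScatteringForms

end

open ScatteringForms

/-!
A closed form `η` whose class lies in `H¹_{∂M}(M)` equals `∑ P k • β k + e`, where `e` is exact and
the coefficients `P` are the periods of `η` over the first `d` dual cycles, because exact forms
have no periods; the periods of `η` over the remaining cycles vanish
(`IsDualSystem.exists_eq_sum_add`). The arithmetic of `η` is thus the
arithmetic of `P`.

For integrality, every cycle is an integral combination of the `σ l` up to a cycle some nonzero
multiple of which is a boundary. Closed forms integrate to zero over boundaries: their pullback to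
the standard triangle is closed, by symmetry of second derivatives, so has a primitive there by the
Poincaré lemma on convex sets (`IsClosedForm.exists_primitive_pullback`). Hence the periods over the
`σ l` decide integrality (`IsClosedForm.isIntegralForm_iff`), and rationality follows by clearing
denominators.

If `η` is Liouville, the periods of the approximating integral forms give the numerators `p`, and
the rate is kept because integration over a fixed cycle is bounded along Fréchet bounded sequences
(`IsFrechetBounded.exists_chainIntegral_bound`). Conversely, given `p` and `q`, the forms
`θ j = ∑ p j k • β k + q j • e` are integral, and `η - θ j / q j = ∑ (P k - p j k / q j) • β k` is a
combination of fixed forms with coefficients of size at most `C / (q j) ^ j`, whatever the exact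
part `e`.
-/

open Set Filter Topology
open scoped Manifold ContDiff

noncomputable section

namespace ScatteringForms

/-! ### Common denominators and rational approximation of linear combinations -/

/-- Finitely many reals are rational iff they have a common denominator. -/
theorem forall_exists_rat_iff {d : ℕ} (P : Fin d → ℝ) :
    (∀ l, ∃ r : ℚ, P l = r) ↔ ∃ q : ℤ, q ≠ 0 ∧ ∀ l, ∃ m : ℤ, (q : ℝ) * P l = m := by
  constructor
  · intro h
    choose r hr using h
    refine ⟨∏ l, ((r l).den : ℤ), Finset.prod_ne_zero_iff.2 fun l _ => by simp, fun l => ?_⟩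
    refine ⟨(∏ k ∈ Finset.univ.erase l, ((r k).den : ℤ)) * (r l).num, ?_⟩
    have h1 : ((r l).den : ℝ) * P l = (r l).num := by
      rw [hr l]
      exact_mod_cast Rat.den_mul_eq_num (r l)
    rw [← Finset.prod_erase_mul _ _ (Finset.mem_univ l)]
    push_cast
    rw [mul_assoc, h1]
  · rintro ⟨q, hq, h⟩ l
    obtain ⟨m, hm⟩ := h l
    refine ⟨m / q, ?_⟩
    push_cast
    rw [← hm, mul_div_cancel_left₀ _ (Int.cast_ne_zero.2 hq)]

/-- Approximating `x` by `Q⁻¹ • y`, where `y` carries the summand `e` of `x` multiplied by `Q`,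
leaves an error in the span of the `b k` alone. -/
theorem smul_sub_inv_smul_sum_add {ι V : Type*} [Fintype ι] [AddCommGroup V] [Module ℝ V]
    {Q : ℝ} (hQ : Q ≠ 0) (c : ℝ) {P p : ι → ℝ} {b : ι → V} {x e : V}
    (hx : x = ∑ k, P k • b k + e) :
    c • (x - Q⁻¹ • (∑ k, p k • b k + Q • e)) = ∑ k, (c * (P k - p k / Q)) • b k := by
  rw [hx, smul_add, inv_smul_smul₀ hQ, Finset.smul_sum, add_sub_add_right_eq_sub,
    ← Finset.sum_sub_distrib, Finset.smul_sum]
  exact Finset.sum_congr rfl fun k _ => by rw [smul_smul, ← sub_smul, smul_smul, inv_mul_eq_div]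

section General

variable {E : Type*} [NormedAddCommGroup E] [NormedSpace ℝ E]
  {H : Type*} [TopologicalSpace H] {I : ModelWithCorners ℝ E H}
  {M : Type*} [TopologicalSpace M] [ChartedSpace H M]
  {V : Type*} [NormedAddCommGroup V] [NormedSpace ℝ V]

/-! ### Smooth maps in charts and pullbacks of 1-forms -/

theorem SmoothPath.contMDiffOn_extend (γ : SmoothPath I M) :
    ContMDiffOn 𝓘(ℝ, ℝ) I ∞ γ.extend (Icc 0 1) := γ.smooth

theorem preimage_source_mem_nhdsWithin {τ : V → M} {S : Set V} {p : V} (hp : p ∈ S)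
    (hτ : ContMDiffOn 𝓘(ℝ, V) I ∞ τ S) {x₀ : M} (hx : τ p ∈ (chartAt H x₀).source) :
    τ ⁻¹' (chartAt H x₀).source ∈ 𝓝[S] p :=
  (hτ p hp).continuousWithinAt.preimage_mem_nhdsWithin
    ((chartAt H x₀).open_source.mem_nhds hx)

variable [IsManifold I ∞ M]

/-- The value of `α` at `x`, with the tangent space unfolded to the model space `E`. -/
def OneForm.valueAt (α : OneForm I M) (x : M) : E →L[ℝ] ℝ := α x

/-- The pullback of `α` by a map `τ` that matters only on a subset `S` of a normed space. It is
built from the derivative within `S`, so it makes sense up to the edges of an interval or a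
triangle. -/
def pullback (α : OneForm I M) (τ : V → M) (S : Set V) (p : V) : V →L[ℝ] ℝ :=
  (α.valueAt (τ p)).comp (mfderivWithin 𝓘(ℝ, V) I τ S p)

theorem contDiffWithinAt_extChartAt_comp {τ : V → M} {S : Set V} {p : V} (hp : p ∈ S)
    (hτ : ContMDiffOn 𝓘(ℝ, V) I ∞ τ S) {x₀ : M} (hx : τ p ∈ (chartAt H x₀).source) :
    ContDiffWithinAt ℝ ∞ (extChartAt I x₀ ∘ τ) S p := by
  rw [← contMDiffWithinAt_iff_contDiffWithinAt]
  exact (contMDiffAt_extChartAt' (n := ∞) hx).comp_contMDiffWithinAt p (hτ p hp)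

/-- In the chart at `x₀`, the pullback is that of the coefficient form by `τ` read in the chart. -/
theorem pullback_eq_inChart_comp (α : OneForm I M) {τ : V → M} {S : Set V} (hS : UniqueDiffOn ℝ S)
    {p : V} (hp : p ∈ S) (hτ : ContMDiffOn 𝓘(ℝ, V) I ∞ τ S) {x₀ : M}
    (hx : τ p ∈ (chartAt H x₀).source) :
    pullback α τ S p = (inChart α x₀ (extChartAt I x₀ (τ p))).comp
      (fderivWithin ℝ (extChartAt I x₀ ∘ τ) S p) := by
  set u := extChartAt I x₀ ∘ τ
  have hx' : τ p ∈ (extChartAt I x₀).source := by simpa using hx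
  have hu : MDifferentiableWithinAt 𝓘(ℝ, V) 𝓘(ℝ, E) u S p :=
    ((contDiffWithinAt_extChartAt_comp hp hτ hx).differentiableWithinAt
      (by simp)).mdifferentiableWithinAt
  have hs : MDifferentiableWithinAt 𝓘(ℝ, E) I (extChartAt I x₀).symm (range I) (u p) :=
    mdifferentiableWithinAt_extChartAt_symm ((extChartAt I x₀).map_source hx')
  have h1 := mfderivWithin_comp p hs hu
    (fun q _ => by simp [u, extChartAt]) (hS p hp).uniqueMDiffWithinAt
  have h2 : mfderivWithin 𝓘(ℝ, V) I ((extChartAt I x₀).symm ∘ u) S p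
      = mfderivWithin 𝓘(ℝ, V) I τ S p := by
    apply Filter.EventuallyEq.mfderivWithin_eq
    · filter_upwards [preimage_source_mem_nhdsWithin hp hτ hx] with q hq
      exact (extChartAt I x₀).left_inv (by simpa using hq)
    · exact (extChartAt I x₀).left_inv hx'
  have h3 : α.valueAt (τ p) = α.valueAt ((extChartAt I x₀).symm (u p)) :=
    congrArg _ ((extChartAt I x₀).left_inv hx').symm
  rw [pullback, h3]
  ext v
  have h4 := congrArg (fun L : V →L[ℝ] E => L v) (h2.symm.trans h1)
  rw [mfderivWithin_eq_fderivWithin] at h4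
  exact congrArg (α.valueAt ((extChartAt I x₀).symm (u p))) h4

theorem eventuallyEq_pullback (α : OneForm I M) {τ : V → M} {S : Set V} (hS : UniqueDiffOn ℝ S)
    {p : V} (hp : p ∈ S) (hτ : ContMDiffOn 𝓘(ℝ, V) I ∞ τ S) {x₀ : M}
    (hx : τ p ∈ (chartAt H x₀).source) :
    pullback α τ S =ᶠ[𝓝[S] p] fun q => (inChart α x₀ ((extChartAt I x₀ ∘ τ) q)).comp
      (fderivWithin ℝ (extChartAt I x₀ ∘ τ) S q) := by
  filter_upwards [preimage_source_mem_nhdsWithin hp hτ hx, self_mem_nhdsWithin] with q hq hqS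
  exact pullback_eq_inChart_comp α hS hqS hτ hq

/-- The derivative of a pullback, computed in the chart at `x₀`: the first term is symmetric in
`v`, `w` because second derivatives are, the second one because `α` is closed. -/
theorem hasFDerivWithinAt_pullback [FiniteDimensional ℝ E] (α : OneForm I M) {τ : V → M}
    {S : Set V} (hS : UniqueDiffOn ℝ S) {p : V} (hp : p ∈ S)
    (hτ : ContMDiffOn 𝓘(ℝ, V) I ∞ τ S) {x₀ : M} (hx : τ p ∈ (chartAt H x₀).source) :
    ∃ D : V →L[ℝ] V →L[ℝ] ℝ, HasFDerivWithinAt (pullback α τ S) D S p ∧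
      ∀ v w, D v w =
        inChart α x₀ ((extChartAt I x₀ ∘ τ) p)
          (fderivWithin ℝ (fderivWithin ℝ (extChartAt I x₀ ∘ τ) S) S p v w) +
        fderivWithin ℝ (inChart α x₀) (range I) ((extChartAt I x₀ ∘ τ) p)
          (fderivWithin ℝ (extChartAt I x₀ ∘ τ) S p v)
          (fderivWithin ℝ (extChartAt I x₀ ∘ τ) S p w) := by
  set u := extChartAt I x₀ ∘ τ
  have hu := contDiffWithinAt_extChartAt_comp hp hτ hx
  have hup : u p ∈ (extChartAt I x₀).target :=
    (extChartAt I x₀).map_source (by simpa using hx)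
  have h1 : HasFDerivWithinAt (fun q => inChart α x₀ (u q))
      ((fderivWithin ℝ (inChart α x₀) (range I) (u p)).comp (fderivWithin ℝ u S p)) S p :=
    (differentiableWithinAt_inChart α x₀ hup).hasFDerivWithinAt.comp p
      (hu.differentiableWithinAt (by simp)).hasFDerivWithinAt
      (fun q _ => by simp [u, extChartAt])
  have h2 : HasFDerivWithinAt (fderivWithin ℝ u S)
      (fderivWithin ℝ (fderivWithin ℝ u S) S p) S p :=
    ((hu.fderivWithin_right (m := ∞) hS (by simp) hp).differentiableWithinAt
      (by simp)).hasFDerivWithinAt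
  refine ⟨_, (h1.clm_comp h2).congr_of_eventuallyEq (eventuallyEq_pullback α hS hp hτ hx)
    (pullback_eq_inChart_comp α hS hp hτ hx), fun v w => ?_⟩
  simp [u]

theorem continuousOn_pullback [FiniteDimensional ℝ E] (α : OneForm I M) {τ : V → M}
    {S : Set V} (hS : UniqueDiffOn ℝ S) (hτ : ContMDiffOn 𝓘(ℝ, V) I ∞ τ S) :
    ContinuousOn (pullback α τ S) S := by
  intro p hp
  obtain ⟨D, hD, -⟩ := hasFDerivWithinAt_pullback α hS hp hτ (mem_chart_source H (τ p))
  exact hD.continuousWithinAt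

/-- The pullback of a closed form to a convex set with nonempty interior is closed, hence exact
by the Poincaré lemma. -/
theorem IsClosedForm.exists_primitive_pullback [FiniteDimensional ℝ E] {α : OneForm I M}
    (hα : IsClosedForm α) {τ : V → M} {S : Set V} (hS : Convex ℝ S) (hS' : (interior S).Nonempty)
    (hτ : ContMDiffOn 𝓘(ℝ, V) I ∞ τ S) :
    ∃ f : V → ℝ, ∀ p ∈ S, HasFDerivWithinAt f (pullback α τ S p) S p := by
  have hU : UniqueDiffOn ℝ S := uniqueDiffOn_convex hS hS'
  have key := fun p hp => hasFDerivWithinAt_pullback α hU (p := p) hp hτ (mem_chart_source H (τ p))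
  refine hS.exists_forall_hasFDerivWithinAt_of_fderivWithin_symmetric
    (fun p hp => (key p hp).choose_spec.1.differentiableWithinAt) fun p hp v _ w _ => ?_
  obtain ⟨D, hD, hD'⟩ := key p hp
  have hsymm : IsSymmSndFDerivWithinAt ℝ (extChartAt I (τ p) ∘ τ) S p :=
    (contDiffWithinAt_extChartAt_comp hp hτ (mem_chart_source H (τ p))).isSymmSndFDerivWithinAt
      (by simpa using WithTop.coe_le_coe.2 (le_top (a := (2 : ℕ∞)))) hU
      (hS.closure_interior_eq_closure_of_nonempty_interior hS' ▸ subset_closure hp) hp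
  rw [hD.fderivWithin (hU p hp), hD', hD', hsymm v w,
    hα (τ p) _ (by simp)]

/-! ### Integration along paths and over chains -/

/-- The integrand of `∫_γ α`. -/
def pathIntegrand (α : OneForm I M) (γ : SmoothPath I M) (t : ℝ) : ℝ :=
  pullback α γ.extend (Icc 0 1) t 1

theorem uniqueDiffOn_unitInterval : UniqueDiffOn ℝ (Icc (0 : ℝ) 1) := uniqueDiffOn_Icc zero_lt_one

theorem pathIntegral_eq (α : OneForm I M) (γ : SmoothPath I M) :
    pathIntegral α γ = ∫ t in (0 : ℝ)..1, pathIntegrand α γ t := rfl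

theorem pathIntegral_smul (c : ℝ) (α : OneForm I M) (γ : SmoothPath I M) :
    pathIntegral (c • α) γ = c * pathIntegral α γ := by
  simp only [pathIntegral_eq]
  rw [← intervalIntegral.integral_const_mul]
  rfl

theorem pathIntegrand_face (α : OneForm I M) (τ : SmoothTriangle I M) {a : ℝ → ℝ × ℝ}
    (ha : ContDiff ℝ ∞ a) (hm : MapsTo a (Icc 0 1) triangle) {t : ℝ} (ht : t ∈ Icc (0 : ℝ) 1) :
    pathIntegrand α (τ.face a ha hm) t = pullback α τ.toFun triangle (a t)
      (fderivWithin ℝ a (Icc 0 1) t 1) := by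
  have he : EqOn (τ.face a ha hm).extend (τ.toFun ∘ a) (Icc 0 1) := fun s hs => by
    simp only [SmoothPath.extend, IccExtend_of_mem _ _ hs]
    rfl
  have h1 : mfderivWithin 𝓘(ℝ, ℝ) I (τ.face a ha hm).extend (Icc 0 1) t
      = mfderivWithin 𝓘(ℝ, ℝ) I (τ.toFun ∘ a) (Icc 0 1) t :=
    mfderivWithin_congr he (he ht)
  have h2 := mfderivWithin_comp t
    ((τ.smooth (a t) (hm ht)).mdifferentiableWithinAt (by simp))
    ((ha.contMDiff.contMDiffAt.mdifferentiableAt (by simp)).mdifferentiableWithinAt) hm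
    (uniqueDiffOn_unitInterval t ht).uniqueMDiffWithinAt
  have h3 : α.valueAt ((τ.face a ha hm).extend t) = α.valueAt (τ.toFun (a t)) :=
    congrArg _ (he ht)
  have h4 := congrArg (fun L : ℝ →L[ℝ] E => L 1) (h1.trans h2)
  rw [mfderivWithin_eq_fderivWithin] at h4
  rw [pathIntegrand, pullback, h3]
  exact congrArg (α.valueAt (τ.toFun (a t))) h4

/-! ### Continuity of integration in the Fréchet topology -/

/-- Cover `[0, 1]` by finitely many compact sets, each mapped into one chart; there the integrand is
the coefficient form evaluated on a bounded velocity. -/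
theorem IsFrechetBounded.exists_pathIntegral_bound {α : ℕ → OneForm I M}
    (hα : IsFrechetBounded α) (γ : SmoothPath I M) : ∃ C, ∀ j, |pathIntegral (α j) γ| ≤ C := by
  obtain ⟨C, hC⟩ : ∃ C, ∀ j, ∀ t ∈ Icc (0 : ℝ) 1, |pathIntegrand (α j) γ t| ≤ C := by
    refine isCompact_Icc.induction_on (p := fun s => ∃ C, ∀ j, ∀ t ∈ s,
      |pathIntegrand (α j) γ t| ≤ C) ⟨0, by simp⟩ ?_ ?_ ?_
    · rintro s t hst ⟨C, hC⟩
      exact ⟨C, fun j x hx => hC j x (hst hx)⟩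
    · rintro s t ⟨C, hC⟩ ⟨C', hC'⟩
      exact ⟨max C C', fun j x hx => hx.elim (fun h => (hC j x h).trans (le_max_left _ _))
        fun h => (hC' j x h).trans (le_max_right _ _)⟩
    · intro t ht
      set x₀ := γ.extend t
      set u := extChartAt I x₀ ∘ γ.extend
      have hsrc := preimage_source_mem_nhdsWithin ht γ.contMDiffOn_extend (mem_chart_source H x₀)
      obtain ⟨r, hr, hrs⟩ :=
        (nhdsWithin_hasBasis Metric.nhds_basis_closedBall (Icc (0 : ℝ) 1)).mem_iff.1 hsrc
      set N := Metric.closedBall t r ∩ Icc 0 1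
      have hN : IsCompact N := (isCompact_closedBall t r).inter_right isClosed_Icc
      have hu : ∀ s ∈ N, ContDiffWithinAt ℝ ∞ u (Icc 0 1) s := fun s hs =>
        contDiffWithinAt_extChartAt_comp hs.2 γ.contMDiffOn_extend (hrs hs)
      have huN : ContinuousOn u N := fun s hs =>
        (hu s hs).continuousWithinAt.mono inter_subset_right
      have hut : u '' N ⊆ (extChartAt I x₀).target := by
        rintro _ ⟨s, hs, rfl⟩
        exact (extChartAt I x₀).map_source (by simpa using hrs hs)
      obtain ⟨A, hA⟩ := hα x₀ (u '' N) (hN.image_of_continuousOn huN) hut 0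
      have hd : ContinuousOn (fderivWithin ℝ u (Icc 0 1)) N := fun s hs =>
        (((hu s hs).fderivWithin_right (m := ∞) uniqueDiffOn_unitInterval (by simp)
          hs.2).continuousWithinAt).mono inter_subset_right
      obtain ⟨B, hB⟩ := hN.exists_bound_of_continuousOn hd
      refine ⟨N, inter_mem (mem_nhdsWithin_of_mem_nhds (Metric.closedBall_mem_nhds t hr))
        self_mem_nhdsWithin, A * B, fun j s hs => ?_⟩
      rw [pathIntegrand, pullback_eq_inChart_comp (α j) uniqueDiffOn_unitInterval hs.2
        γ.contMDiffOn_extend (hrs hs), ContinuousLinearMap.comp_apply]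
      have hA' : ‖inChart (α j) x₀ (u s)‖ ≤ A := by
        simpa using hA j (u s) (mem_image_of_mem u hs)
      calc |inChart (α j) x₀ (u s) (fderivWithin ℝ u (Icc 0 1) s 1)|
          ≤ ‖inChart (α j) x₀ (u s)‖ * ‖fderivWithin ℝ u (Icc 0 1) s 1‖ :=
            (inChart (α j) x₀ (u s)).le_opNorm _
        _ ≤ A * B := by
            refine mul_le_mul hA' ?_ (norm_nonneg _) ((norm_nonneg _).trans hA')
            exact ((ContinuousLinearMap.le_opNorm _ _).trans (by simp)).trans (hB s hs)
  refine ⟨C, fun j => ?_⟩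
  have h := intervalIntegral.norm_integral_le_of_norm_le_const (a := 0) (b := 1) (C := C)
    (f := pathIntegrand (α j) γ)
    fun t ht => hC j t (Ioc_subset_Icc_self (uIoc_of_le (zero_le_one' ℝ) ▸ ht))
  simpa [pathIntegral_eq] using h

theorem IsFrechetBounded.exists_chainIntegral_bound {α : ℕ → OneForm I M}
    (hα : IsFrechetBounded α) (c : OneChain I M) : ∃ C, ∀ j, |chainIntegral (α j) c| ≤ C := by
  choose C hC using hα.exists_pathIntegral_bound
  refine ⟨∑ γ ∈ c.support, |(c γ : ℝ)| * C γ, fun j => ?_⟩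
  refine (Finset.abs_sum_le_sum_abs _ _).trans (Finset.sum_le_sum fun γ _ => ?_)
  rw [abs_mul]
  exact mul_le_mul_of_nonneg_left (hC γ j) (abs_nonneg _)

/-! ### The pairing of forms with chains -/

variable [FiniteDimensional ℝ E]

theorem intervalIntegrable_pathIntegrand (α : OneForm I M) (γ : SmoothPath I M) :
    IntervalIntegrable (pathIntegrand α γ) MeasureTheory.volume 0 1 := by
  apply ContinuousOn.intervalIntegrable
  rw [uIcc_of_le zero_le_one]
  exact (continuousOn_pullback α uniqueDiffOn_unitInterval γ.contMDiffOn_extend).clm_apply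
    continuousOn_const

theorem pathIntegral_add (α β : OneForm I M) (γ : SmoothPath I M) :
    pathIntegral (α + β) γ = pathIntegral α γ + pathIntegral β γ := by
  simp only [pathIntegral_eq]
  rw [← intervalIntegral.integral_add (intervalIntegrable_pathIntegrand α γ)
    (intervalIntegrable_pathIntegrand β γ)]
  rfl

/-- Integration over chains, as a bilinear pairing of 1-forms with integral 1-chains. -/
def chainPairing : OneForm I M →ₗ[ℝ] OneChain I M →ₗ[ℤ] ℝ where
  toFun α := Finsupp.linearCombination ℤ (pathIntegral α)
  map_add' α β := by
    ext γ
    simp [pathIntegral_add]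
  map_smul' c α := by
    ext γ
    simp [pathIntegral_smul]

theorem chainIntegral_eq_chainPairing (α : OneForm I M) (c : OneChain I M) :
    chainIntegral α c = chainPairing α c := by
  simp [chainIntegral, chainPairing, Finsupp.linearCombination_apply]

/-- Fundamental theorem of calculus for a primitive of the integrand along the path. -/
theorem pathIntegral_eq_sub (α : OneForm I M) (γ : SmoothPath I M) {F : ℝ → ℝ}
    (hF : ∀ t ∈ Icc (0 : ℝ) 1, HasDerivWithinAt F (pathIntegrand α γ t) (Icc 0 1) t) :
    pathIntegral α γ = F 1 - F 0 :=
  intervalIntegral.integral_eq_sub_of_hasDerivAt_of_le zero_le_one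
    (fun t ht => (hF t ht).continuousWithinAt)
    (fun t ht => (hF t (Ioo_subset_Icc_self ht)).hasDerivAt (Icc_mem_nhds ht.1 ht.2))
    (intervalIntegrable_pathIntegrand α γ)

/-! ### Vanishing of the periods of exact forms, and Stokes' theorem for closed forms -/

theorem IsDifferentialOf.pathIntegral_eq_sub {α : OneForm I M} {f : M → ℝ}
    (hf : ContMDiff I 𝓘(ℝ, ℝ) ∞ f) (h : IsDifferentialOf α f) (γ : SmoothPath I M) :
    pathIntegral α γ = f (γ.toFun 1) - f (γ.toFun 0) := by
  have hF : ∀ t ∈ Icc (0 : ℝ) 1,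
      HasDerivWithinAt (f ∘ γ.extend) (pathIntegrand α γ t) (Icc 0 1) t := by
    intro t ht
    have h1 : HasMFDerivWithinAt 𝓘(ℝ, ℝ) 𝓘(ℝ, ℝ) (f ∘ γ.extend) (Icc 0 1) t _ :=
      ((hf.mdifferentiable (by simp) (γ.extend t)).hasMFDerivAt).comp_hasMFDerivWithinAt t
        ((γ.contMDiffOn_extend t ht).mdifferentiableWithinAt (by simp)).hasMFDerivWithinAt
    have h2 : HasFDerivWithinAt (𝕜 := ℝ) (f ∘ γ.extend) (pullback α γ.extend (Icc 0 1) t)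
        (Icc 0 1) t := by
      refine h1.hasFDerivWithinAt.congr_fderiv (ContinuousLinearMap.ext fun v => ?_)
      exact (h (γ.extend t) _).symm
    exact h2.hasDerivWithinAt
  rw [ScatteringForms.pathIntegral_eq_sub α γ hF]
  simp [SmoothPath.extend]

theorem IsDifferentialOf.chainIntegral_eq_zero {α : OneForm I M} {f : M → ℝ}
    (hf : ContMDiff I 𝓘(ℝ, ℝ) ∞ f) (h : IsDifferentialOf α f) {c : OneChain I M}
    (hc : c ∈ cycles I M) : chainIntegral α c = 0 := by
  -- `∫_c df` is `f` evaluated on the boundary of `c`.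
  have key : chainPairing α = (Finsupp.linearCombination ℤ f).comp (boundaryMap I M) := by
    ext γ
    simp [chainPairing, boundaryMap, h.pathIntegral_eq_sub hf]
  rw [chainIntegral_eq_chainPairing, key, LinearMap.comp_apply, LinearMap.mem_ker.1 hc, map_zero]

theorem convex_triangle : Convex ℝ triangle := by
  rintro ⟨a, b⟩ ⟨ha, hb, hab⟩ ⟨a', b'⟩ ⟨ha', hb', hab'⟩ s t hs ht hst
  simp only [triangle, mem_ofPred_eq, Prod.smul_mk, Prod.mk_add_mk, smul_eq_mul] at *
  refine ⟨by positivity, by positivity, ?_⟩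
  nlinarith

theorem interior_triangle_nonempty : (interior triangle).Nonempty := by
  refine ⟨(1 / 4, 1 / 4), mem_interior.2 ⟨{p | 0 < p.1 ∧ 0 < p.2 ∧ p.1 + p.2 < 1},
    fun p hp => ⟨hp.1.le, hp.2.1.le, hp.2.2.le⟩, ?_, by norm_num⟩⟩
  exact (isOpen_lt continuous_const continuous_fst).inter
    ((isOpen_lt continuous_const continuous_snd).inter
      (isOpen_lt (continuous_fst.add continuous_snd) continuous_const))

/-- Stokes: the pullback to the triangle has a primitive, whose differences along the three edges
cancel. -/
theorem IsClosedForm.chainIntegral_boundary {α : OneForm I M} (hα : IsClosedForm α)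
    (τ : SmoothTriangle I M) : chainIntegral α τ.boundary = 0 := by
  obtain ⟨f, hf⟩ := hα.exists_primitive_pullback convex_triangle interior_triangle_nonempty
    τ.smooth
  have key : ∀ (a : ℝ → ℝ × ℝ) (ha : ContDiff ℝ ∞ a) (hm : MapsTo a (Icc 0 1) triangle),
      pathIntegral α (τ.face a ha hm) = f (a 1) - f (a 0) := by
    intro a ha hm
    refine pathIntegral_eq_sub α _ (F := f ∘ a) fun t ht => ?_
    rw [pathIntegrand_face α τ ha hm ht]
    exact ((hf (a t) (hm ht)).comp t
      ((ha.differentiable (by simp) t).differentiableWithinAt.hasFDerivWithinAt)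
        hm).hasDerivWithinAt
  rw [chainIntegral_eq_chainPairing, SmoothTriangle.boundary]
  simp only [chainPairing, LinearMap.coe_mk, AddHom.coe_mk, map_add, map_sub,
    Finsupp.linearCombination_single, one_smul]
  refine (congrArg₂ (· + ·) (congrArg₂ (· - ·) (key (fun t => (1 - t, t)) _ _)
    (key (fun t => (0, t)) _ _)) (key (fun t => (t, 0)) _ _)).trans ?_
  norm_num

theorem IsClosedForm.chainIntegral_eq_zero_of_mem_boundaries {α : OneForm I M}
    (hα : IsClosedForm α) {c : OneChain I M} (hc : c ∈ boundaries I M) :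
    chainIntegral α c = 0 := by
  have h : boundaries I M ≤ LinearMap.ker (chainPairing α) := by
    refine Submodule.span_le.2 ?_
    rintro _ ⟨τ, rfl⟩
    rw [SetLike.mem_coe, LinearMap.mem_ker, ← chainIntegral_eq_chainPairing,
      hα.chainIntegral_boundary]
  rw [chainIntegral_eq_chainPairing]
  exact h hc

/-- The integral of a closed form over a cycle depends only on the class of the cycle in the free
part of `H₁(M; ℤ)`: a torsion class has a nonzero multiple that bounds. -/
theorem IsClosedForm.chainIntegral_eq_zero_of_freeClass_eq_zero {α : OneForm I M}
    (hα : IsClosedForm α) {c : cycles I M} (hc : freeClass c = 0) :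
    chainIntegral α (c : OneChain I M) = 0 := by
  obtain ⟨⟨N, hN⟩, h⟩ := (Submodule.mem_torsion_iff _).1 ((Submodule.Quotient.mk_eq_zero _).1 hc)
  have h1 : N • c ∈ (boundaries I M).submoduleOf (cycles I M) :=
    (Submodule.Quotient.mk_eq_zero _).1 h
  have h2 := hα.chainIntegral_eq_zero_of_mem_boundaries (c := N • (c : OneChain I M)) h1
  rw [chainIntegral_eq_chainPairing, map_smul, zsmul_eq_mul] at h2
  rw [chainIntegral_eq_chainPairing]
  exact (mul_eq_zero.1 h2).resolve_left (Int.cast_ne_zero.2 (nonZeroDivisors.ne_zero hN))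

/-! ### Fréchet boundedness of linear combinations -/

theorem IsFrechetBounded.add {α β : ℕ → OneForm I M} (hα : IsFrechetBounded α)
    (hβ : IsFrechetBounded β) : IsFrechetBounded fun j => α j + β j := by
  intro x₀ K hK hKt k
  obtain ⟨A, hA⟩ := hα x₀ K hK hKt k
  obtain ⟨B, hB⟩ := hβ x₀ K hK hKt k
  refine ⟨A + B, fun j y hy => ?_⟩
  have hd : ∀ δ : OneForm I M, ContDiffWithinAt ℝ k (inChart δ x₀) (range I) y := fun δ =>
    ((contDiffOn_inChart δ x₀ y (hKt hy)).of_le (mod_cast le_top)).mono_of_mem_nhdsWithin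
      (extChartAt_target_mem_nhdsWithin_of_mem (hKt hy))
  rw [inChart_add, iteratedFDerivWithin_add_apply (hd _) (hd _) I.uniqueDiffOn
    (extChartAt_target_subset_range x₀ (hKt hy))]
  exact (norm_add_le _ _).trans (add_le_add (hA j y hy) (hB j y hy))

theorem isFrechetBounded_smul {c : ℕ → ℝ} {C : ℝ} (hc : ∀ j, |c j| ≤ C) (β : OneForm I M) :
    IsFrechetBounded fun j => c j • β := by
  intro x₀ K hK hKt k
  have hd : ∀ y ∈ K, ContDiffWithinAt ℝ k (inChart β x₀) (range I) y := fun y hy =>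
    ((contDiffOn_inChart β x₀ y (hKt hy)).of_le (mod_cast le_top)).mono_of_mem_nhdsWithin
      (extChartAt_target_mem_nhdsWithin_of_mem (hKt hy))
  have hcont : ContinuousOn (iteratedFDerivWithin ℝ k (inChart β x₀) (range I)) K := fun y hy =>
    ((hd y hy).continuousWithinAt_iteratedFDerivWithin I.uniqueDiffOn le_rfl
      (extChartAt_target_subset_range x₀ (hKt hy))).mono
      (hKt.trans (extChartAt_target_subset_range x₀))
  obtain ⟨B, hB⟩ := hK.exists_bound_of_continuousOn hcont
  refine ⟨C * B, fun j y hy => ?_⟩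
  rw [inChart_smul, iteratedFDerivWithin_const_smul_apply (hd y hy) I.uniqueDiffOn
    (extChartAt_target_subset_range x₀ (hKt hy)), norm_smul]
  exact mul_le_mul (hc j) (hB y hy) (norm_nonneg _) ((abs_nonneg _).trans (hc j))

theorem isFrechetBounded_sum_smul {ι : Type*} (s : Finset ι) {c : ℕ → ι → ℝ} {C : ℝ}
    (hc : ∀ j, ∀ k ∈ s, |c j k| ≤ C) (β : ι → OneForm I M) :
    IsFrechetBounded fun j => ∑ k ∈ s, c j k • β k := by
  classical
  induction s using Finset.induction_on with
  | empty =>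
    have h := isFrechetBounded_smul (c := fun _ => 0) (C := 0) (by simp) (0 : OneForm I M)
    rwa [funext fun _ : ℕ => smul_zero (A := OneForm I M) (0 : ℝ)] at h
  | insert k s hk ih =>
    simp only [Finset.sum_insert hk]
    exact (isFrechetBounded_smul (fun j => hc j k (Finset.mem_insert_self k s)) (β k)).add
      (ih fun j l hl => hc j l (Finset.mem_insert_of_mem hl))

/-! ### Periods and integrality -/

/-- The vector of periods over `σ`, as a linear map on 1-forms. -/
def periodMap {d : ℕ} (σ : Fin d → cycles I M) : OneForm I M →ₗ[ℝ] (Fin d → ℝ) where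
  toFun := periodVector σ
  map_add' α β := by
    ext l
    simp [periodVector, chainIntegral_eq_chainPairing, mul_add]
  map_smul' c α := by
    ext l
    simp [periodVector, chainIntegral_eq_chainPairing]
    ring

theorem periodMap_apply {d : ℕ} (σ : Fin d → cycles I M) (α : OneForm I M) :
    periodMap σ α = periodVector σ α := rfl

theorem periodMap_eq_zero_of_mem_exactForms {d : ℕ} (σ : Fin d → cycles I M)
    {e : closedForms I M} (he : e ∈ exactForms I M) : periodMap σ e.1 = 0 := by
  obtain ⟨f, hf, h⟩ := he
  ext l
  simp [periodMap_apply, periodVector, h.chainIntegral_eq_zero hf (σ l).2]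

/-- Periods over a generating family of the free part of `H₁(M; ℤ)` decide integrality. -/
theorem IsClosedForm.isIntegralForm_iff {α : OneForm I M} (hα : IsClosedForm α) {d : ℕ}
    {σ : Fin d → cycles I M} (hσ : Submodule.span ℤ (range fun l => freeClass (σ l)) = ⊤) :
    IsIntegralForm α ↔ ∀ l, ∃ m : ℤ, periodVector σ α l = m := by
  have hπ : 2 * Real.pi ≠ 0 := by positivity
  constructor
  · intro h l
    obtain ⟨m, hm⟩ := h (σ l) (σ l).2
    exact ⟨m, by rw [periodVector, hm]; field_simp⟩
  · intro h c hc
    choose m hm using h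
    obtain ⟨a, ha⟩ := (Submodule.mem_span_range_iff_exists_fun ℤ).1
      (hσ ▸ Submodule.mem_top : freeClass ⟨c, hc⟩ ∈ _)
    have h0 : freeClass ((⟨c, hc⟩ : cycles I M) - ∑ l, a l • σ l) = 0 := by
      let F : cycles I M →ₗ[ℤ] FreeH1 I M := (Submodule.mkQ _).comp (Submodule.mkQ _)
      have hF : ∀ z, freeClass z = F z := fun _ => rfl
      simp only [hF] at ha ⊢
      rw [map_sub, map_sum, ← ha]
      simp
    have h1 := hα.chainIntegral_eq_zero_of_freeClass_eq_zero h0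
    have h2 : ∀ l, chainIntegral α (σ l : OneChain I M) = 2 * Real.pi * m l := fun l => by
      rw [← hm l, periodVector]
      field_simp
    simp only [chainIntegral_eq_chainPairing] at h1 h2
    rw [Submodule.coe_sub, map_sub, sub_eq_zero] at h1
    refine ⟨∑ l, a l * m l, ?_⟩
    rw [chainIntegral_eq_chainPairing, h1]
    simp [h2, Finset.mul_sum]
    exact Finset.sum_congr rfl fun l _ => by ring

/-! ### Periods of approximating forms -/

/-- The periods of a Liouville form are simultaneously approximated by those of the approximating
integral forms, since integration over a fixed cycle is continuous in the Fréchet topology. -/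
theorem exists_approximation_of_isFrechetBounded
    {d : ℕ} {α : OneForm I M} (τ : Fin d → cycles I M)
    {θ : ℕ → OneForm I M} {q : ℕ → ℤ} (hq : ∀ j, 2 ≤ q j)
    (hb : IsFrechetBounded fun j => ((q j : ℝ) ^ j) • (α - (q j : ℝ)⁻¹ • θ j)) :
    ∃ C : ℝ, 0 < C ∧ ∀ j,
      ∑ l, |periodVector τ α l - periodVector τ (θ j) l / q j| ≤ C / (q j : ℝ) ^ j := by
  choose B hB using fun l => hb.exists_chainIntegral_bound (τ l : OneChain _ _)
  refine ⟨∑ l, 1 / (2 * Real.pi) * |B l| + 1, by positivity, fun j => ?_⟩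
  have hq0 : (0 : ℝ) < (q j : ℝ) ^ j :=
    pow_pos (by exact_mod_cast (zero_lt_two.trans_le (hq j))) j
  rw [le_div_iff₀ hq0, Finset.sum_mul]
  refine (Finset.sum_le_sum fun l _ => ?_).trans (le_add_of_nonneg_right zero_le_one)
  have h1 : periodMap τ (((q j : ℝ) ^ j) • (α - (q j : ℝ)⁻¹ • θ j)) =
      ((q j : ℝ) ^ j) • (periodMap τ α - (q j : ℝ)⁻¹ • periodMap τ (θ j)) := by
    rw [map_smul, map_sub, map_smul]
  calc |periodVector τ α l - periodVector τ (θ j) l / q j| * (q j : ℝ) ^ j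
      = |periodVector τ (((q j : ℝ) ^ j) • (α - (q j : ℝ)⁻¹ • θ j)) l| := by
        simp only [← periodMap_apply, h1, Pi.smul_apply, Pi.sub_apply, smul_eq_mul]
        rw [abs_mul, abs_of_pos hq0, mul_comm, inv_mul_eq_div]
    _ ≤ 1 / (2 * Real.pi) * |B l| := by
        rw [periodVector, abs_mul, abs_of_pos (a := 1 / (2 * Real.pi)) (by positivity)]
        exact mul_le_mul_of_nonneg_left ((hB l j).trans (le_abs_self _)) (by positivity)

end General

section Boundary

variable {n : ℕ} [NeZero n] {Mbar : Type*} [TopologicalSpace Mbar]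
  [ChartedSpace (EuclideanHalfSpace n) Mbar] [IsManifold (𝓡∂ n) ∞ Mbar]
  {d d' : ℕ} {hd : d ≤ d'}
  {β : Fin d' → closedForms (𝓡∂ n) (Interior n Mbar)}
  {σ : Fin d' → cycles (𝓡∂ n) (Interior n Mbar)}

/-! ### Forms with class in the relative image -/

theorem IsDualSystem.periodVector_sum (hβσ : IsDualSystem hd β σ) (a : Fin d → ℝ)
    {e : closedForms (𝓡∂ n) (Interior n Mbar)} (he : e ∈ exactForms (𝓡∂ n) (Interior n Mbar))
    (l : Fin d') :
    periodVector σ (∑ k, a k • β (Fin.castLE hd k) + e).1 l =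
      ∑ k, if Fin.castLE hd k = l then a k else 0 := by
  have h := congrFun (periodMap_eq_zero_of_mem_exactForms σ he) l
  rw [← periodMap_apply]
  simp only [Submodule.coe_add, Submodule.coe_sum, Submodule.coe_smul, map_add, map_sum, map_smul,
    Pi.add_apply]
  simp only [h, Finset.sum_apply, Pi.smul_apply, periodMap_apply, hβσ.dual]
  simp

theorem IsDualSystem.periodVector_sum_castLE (hβσ : IsDualSystem hd β σ) (a : Fin d → ℝ)
    {e : closedForms (𝓡∂ n) (Interior n Mbar)} (he : e ∈ exactForms (𝓡∂ n) (Interior n Mbar))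
    (l : Fin d) :
    periodVector σ (∑ k, a k • β (Fin.castLE hd k) + e).1 (Fin.castLE hd l) = a l := by
  rw [hβσ.periodVector_sum a he]
  simp

/-- A closed form with class in `H¹_{∂M}(M)` is, up to an exact form, the combination of the basis
forms whose coefficients are its periods. -/
theorem IsDualSystem.exists_eq_sum_add (hβσ : IsDualSystem hd β σ)
    {η : closedForms (𝓡∂ n) (Interior n Mbar)}
    (hη : (Submodule.Quotient.mk η : DeRhamH1 (𝓡∂ n) (Interior n Mbar)) ∈ relativeImage n Mbar) :
    ∃ e ∈ exactForms (𝓡∂ n) (Interior n Mbar),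
      η = ∑ k, periodVector σ η.1 (Fin.castLE hd k) • β (Fin.castLE hd k) + e := by
  rw [← hβσ.relative_span, Submodule.mem_span_range_iff_exists_fun] at hη
  obtain ⟨a, ha⟩ := hη
  have he : η - ∑ k, a k • β (Fin.castLE hd k) ∈ exactForms (𝓡∂ n) (Interior n Mbar) := by
    rw [← Submodule.Quotient.eq, ← ha]
    simp only [← Submodule.mkQ_apply, map_sum, map_smul]
  have h : η = ∑ k, a k • β (Fin.castLE hd k) + (η - ∑ k, a k • β (Fin.castLE hd k)) := by abel
  have hper : ∀ k, periodVector σ η.1 (Fin.castLE hd k) = a k := fun k => by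
    rw [h, hβσ.periodVector_sum_castLE a he]
  exact ⟨_, he, by simpa only [hper] using h⟩

/-- By duality the periods of such a combination are its coefficients over the first `d` cycles and
zero over the others. -/
theorem IsDualSystem.isIntegralForm_sum_add (hβσ : IsDualSystem hd β σ) {a : Fin d → ℝ}
    (ha : ∀ k, ∃ m : ℤ, a k = m)
    {e : closedForms (𝓡∂ n) (Interior n Mbar)} (he : e ∈ exactForms (𝓡∂ n) (Interior n Mbar)) :
    IsIntegralForm (∑ k, a k • β (Fin.castLE hd k) + e).1 := by
  choose m hm using ha
  refine (IsClosedForm.isIntegralForm_iff (Subtype.property _) hβσ.cycles_span).2 fun l =>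
    ⟨∑ k, if Fin.castLE hd k = l then m k else 0, ?_⟩
  rw [hβσ.periodVector_sum a he]
  simp [hm]

theorem IsDualSystem.isIntegralForm_iff (hβσ : IsDualSystem hd β σ)
    {η : closedForms (𝓡∂ n) (Interior n Mbar)}
    (hη : (Submodule.Quotient.mk η : DeRhamH1 (𝓡∂ n) (Interior n Mbar)) ∈ relativeImage n Mbar) :
    IsIntegralForm η.1 ↔ ∀ l, ∃ m : ℤ, periodVector σ η.1 (Fin.castLE hd l) = m := by
  constructor
  · exact fun h l => (IsClosedForm.isIntegralForm_iff η.2 hβσ.cycles_span).1 h _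
  · intro h
    obtain ⟨e, he, hηe⟩ := hβσ.exists_eq_sum_add hη
    rw [hηe]
    exact hβσ.isIntegralForm_sum_add h he

theorem IsDualSystem.isRationalForm_iff (hβσ : IsDualSystem hd β σ)
    {η : closedForms (𝓡∂ n) (Interior n Mbar)}
    (hη : (Submodule.Quotient.mk η : DeRhamH1 (𝓡∂ n) (Interior n Mbar)) ∈ relativeImage n Mbar) :
    IsRationalForm η.1 ↔ ∀ l, ∃ r : ℚ, periodVector σ η.1 (Fin.castLE hd l) = r := by
  rw [forall_exists_rat_iff fun l => periodVector σ η.1 (Fin.castLE hd l)]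
  refine exists_congr fun q => and_congr_right fun _ => ?_
  have h := hβσ.isIntegralForm_iff (η := (q : ℝ) • η) (Submodule.smul_mem _ (q : ℝ) hη)
  simpa only [Submodule.coe_smul, ← periodMap_apply, map_smul, Pi.smul_apply, smul_eq_mul] using h

theorem IsDualSystem.isLiouvilleForm_iff (hβσ : IsDualSystem hd β σ)
    {η : closedForms (𝓡∂ n) (Interior n Mbar)}
    (hη : (Submodule.Quotient.mk η : DeRhamH1 (𝓡∂ n) (Interior n Mbar)) ∈ relativeImage n Mbar) :
    IsLiouvilleForm η.1 ↔
      (¬ ∀ l, ∃ r : ℚ, periodVector σ η.1 (Fin.castLE hd l) = r) ∧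
      ∃ (p : ℕ → Fin d → ℤ) (q : ℕ → ℕ) (C : ℝ),
        (∀ j, 2 ≤ q j) ∧ Tendsto q atTop atTop ∧ 0 < C ∧
        ∀ j, ∑ l, |periodVector σ η.1 (Fin.castLE hd l) - (p j l : ℝ) / (q j : ℝ)|
          ≤ C / (q j : ℝ) ^ j := by
  refine and_congr (not_congr (hβσ.isRationalForm_iff hη)) ⟨?_, ?_⟩
  · rintro ⟨θ, q, hθ, hq, hqt, hb⟩
    choose p hp using fun j (l : Fin d) =>
      ((hθ j).1.isIntegralForm_iff hβσ.cycles_span).1 (hθ j).2 (Fin.castLE hd l)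
    obtain ⟨C, hC, h⟩ := exists_approximation_of_isFrechetBounded
      (fun l => σ (Fin.castLE hd l)) hq hb
    have hcast : ∀ j, ((q j).toNat : ℝ) = q j := fun j => by
      exact_mod_cast Int.toNat_of_nonneg (zero_le_two.trans (hq j))
    refine ⟨p, fun j => (q j).toNat, C, fun j => ?_, ?_, hC, fun j => ?_⟩
    · show 2 ≤ (q j).toNat
      have := hq j
      omega
    · refine tendsto_atTop.2 fun N => ?_
      filter_upwards [tendsto_atTop.1 hqt N] with j hj
      omega
    · rw [hcast]
      simp only [← hp]
      exact h j
  · rintro ⟨p, q, C, hq, hqt, -, h⟩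
    obtain ⟨e, he, hηe⟩ := hβσ.exists_eq_sum_add hη
    -- The exact part of `η` is scaled along, so that it cancels in `η - θ j / q j`.
    refine ⟨fun j => (∑ k, (p j k : ℝ) • β (Fin.castLE hd k) + (q j : ℝ) • e).1, fun j => q j,
      fun j => ⟨Subtype.property _, hβσ.isIntegralForm_sum_add (fun k => ⟨p j k, rfl⟩)
        (Submodule.smul_mem _ _ he)⟩, fun j => ?_, tendsto_natCast_atTop_atTop.comp hqt, ?_⟩
    · exact Nat.cast_le.2 (hq j)
    have hq0 : ∀ j, (0 : ℝ) < q j := fun j => by exact_mod_cast zero_lt_two.trans_le (hq j)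
    set P : Fin d → ℝ := fun k => periodVector σ η.1 (Fin.castLE hd k)
    have hη' : η.1 = ∑ k, P k • (β (Fin.castLE hd k)).1 + e.1 := by
      have h1 := congrArg Subtype.val hηe
      rwa [Submodule.coe_add, Submodule.coe_sum] at h1
    have hdiff : ∀ j, (q j : ℝ) ^ j • (η.1 - (q j : ℝ)⁻¹ •
        (∑ k, (p j k : ℝ) • β (Fin.castLE hd k) + (q j : ℝ) • e).1) =
        ∑ k, ((q j : ℝ) ^ j * (P k - p j k / q j)) • (β (Fin.castLE hd k)).1 := by
      intro j
      rw [Submodule.coe_add, Submodule.coe_sum]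
      exact smul_sub_inv_smul_sum_add (hq0 j).ne' _ hη'
    simp only [Int.cast_natCast, hdiff]
    refine isFrechetBounded_sum_smul Finset.univ (C := C) (fun j k _ => ?_) _
    have hqj := pow_pos (hq0 j) j
    rw [abs_mul, abs_of_pos hqj, mul_comm, ← le_div_iff₀ hqj]
    exact (Finset.single_le_sum (f := fun l => |P l - p j l / q j|) (fun _ _ => abs_nonneg _)
      (Finset.mem_univ k)).trans (h j)

end Boundary

end ScatteringForms

end

open ScatteringForms
theorem mainTheorem3 (n : ℕ) [NeZero n] (Mbar : Type*) [TopologicalSpace Mbar] [T2Space Mbar]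
    [CompactSpace Mbar] [ChartedSpace (EuclideanHalfSpace n) Mbar] [IsManifold (𝓡∂ n) ∞ Mbar]
    {d d' : ℕ} (hd : d ≤ d')
    (β : Fin d' → closedForms (𝓡∂ n) (Interior n Mbar))
    (σ : Fin d' → cycles (𝓡∂ n) (Interior n Mbar))
    (hβσ : IsDualSystem hd β σ)
    (η : closedForms (𝓡∂ n) (Interior n Mbar))
    (hη : (Submodule.Quotient.mk η : DeRhamH1 (𝓡∂ n) (Interior n Mbar)) ∈ relativeImage n Mbar)
    (P : Fin d → ℝ) (hP : P = periodVector (fun l => σ (Fin.castLE hd l)) η.1) :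
    (IsIntegralForm η.1 ↔ ∀ l, ∃ m : ℤ, P l = m) ∧
    (IsRationalForm η.1 ↔ ∀ l, ∃ r : ℚ, P l = r) ∧
    (IsLiouvilleForm η.1 ↔
      (¬ ∀ l, ∃ r : ℚ, P l = r) ∧
      ∃ (p : ℕ → Fin d → ℤ) (q : ℕ → ℕ) (C : ℝ),
        (∀ j, 2 ≤ q j) ∧ Tendsto q atTop atTop ∧ 0 < C ∧
        ∀ j, ∑ l, |P l - (p j l : ℝ) / (q j : ℝ)| ≤ C / (q j : ℝ) ^ j) := by
  subst hP
  exact ⟨hβσ.isIntegralForm_iff hη, hβσ.isRationalForm_iff hη, hβσ.isLiouvilleForm_iff hη⟩
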